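/- Let $\mathbb K$ be $\mathbb R$ or $\mathbb C$; Banach spaces and Lipschitz functions below are over $\mathbb K$. **Notation.** A pointed metric space is a metric space with a base point $0$. For a pointed metric space $X$ and a Banach space $E$, $\mathrm{Lip}_0(X,E)$ is the space of Lipschitz maps $f\colon X\to E$ with $f(0)=0$, $\mathrm{Lip}(f)$ is the least Lipschitz constant of $f$, and $X^\#=\mathrm{Lip}_0(X,\mathbb K)$. For pointed metric spaces $X,Y$, $\mathrm{Lip}_0(X,Y)$ is the set of base-point preserving Lipschitz maps. The Lipschitz tensor product $X\boxtimes E$ is the linear span of the functionals $\delta_{(x,y)}\boxtimes e\colon f\mapsto\langle f(x)-f(y),e\rangle$ on $\mathrm{Lip}_0(X,E^*)$, where $x,y\in X$ and $e\in E$. For $h\in\mathrm{Lip}_0(X,Y)$ and a bounded linear operator $T\colon E\to F$, the linear map $h\boxtimes T\colon X\boxtimes E\to Y\boxtimes F$ is given by $\delta_{(x,y)}\boxtimes e\mapsto\delta_{(h(x),h(y))}\boxtimes T(e)$. Let $\kappa_E\colon E\to E^{**}$ be the canonical injection. **Cross-norms.** A generic Lipschitz cross-norm $\alpha$ assigns to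 each pointed metric space $X$ and each Banach space $E$ a norm $\alpha(\cdot;X,E)$ on $X\boxtimes E$ such that 1. $\alpha(\delta_{(x,y)}\boxtimes e;X,E)=d(x,y)\|e\|$; 2. (dualizable) $\bigl|\sum_i (g(x_i)-g(y_i))\langle\phi,e_i\rangle\bigr|\le\mathrm{Lip}(g)\|\phi\|\,\alpha(u;X,E)$ for all $u=\sum_i\delta_{(x_i,y_i)}\boxtimes e_i\in X\boxtimes E$, $g\in X^\#$, $\phi\in E^*$; 3. (metric mapping property) $\alpha((h\boxtimes T)u;Y,F)\le\mathrm{Lip}(h)\|T\|\,\alpha(u;X,E)$ for all $u\in X\boxtimes E$, $h\in \mathrm{Lip}_0(X,Y)$ and bounded linear $T\colon E\to F$. It is finitely generated if for all $X$, $E$ and $u\in X\boxtimes E$, $\alpha(u;X,E)$ is the infimum of $\alpha(u;X_0,E_0)$ over all finite subsets $X_0\subseteq X$ containing $0$ and all finite-dimensional subspaces $E_0\subseteq E$ with $u\in X_0\boxtimes E_0$ (regarded as a subspace of $X\boxtimes E$ through the canonical injections). We write $X\boxtimes_\alpha E$ for $X\boxtimes E$ with the norm $\alpha$, and $X\widehat\boxtimes_\alpha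 E$ for its completion. **Ideals.** A generic Lipschitz operator Banach ideal $A$ assigns to each pointed metric space $X$ and each Banach space $E$ a linear subspace $A(X,E)$ of $\mathrm{Lip}_0(X,E)$ with a complete norm $\|\cdot\|_A$ such that 1. for $g\in X^\#$ and $e\in E$, the map $g\cdot e\colon x\mapsto g(x)e$ lies in $A(X,E)$ and $\|g\cdot e\|_A\le\mathrm{Lip}(g)\|e\|$; 2. $\mathrm{Lip}(f)\le\|f\|_A$ for all $f\in A(X,E)$; 3. if $f\in A(X,E)$, $h\in\mathrm{Lip}_0(Z,X)$ and $S\colon E\to F$ is bounded and linear, then $S f h\in A(Z,F)$ and $\|Sfh\|_A\le\|S\|\,\|f\|_A\,\mathrm{Lip}(h)$. For $f\in\mathrm{Lip}_0(X,E)$ let $\|f\|_{A^{\max}}\in[0,\infty]$ be the supremum of $\|Q_L\circ f|_Y\|_A$ over all finite $Y\subseteq X$ containing $0$ and all closed finite-codimensional subspaces $L\subseteq E$, where $Q_L\colon E\to E/L$ is the quotient map. The ideal $A$ is maximal if, for all $X$ and $E$, $A(X,E)=\{f\in\mathrm{Lip}_0(X,E):\|f\|_{A^{\max}}<\infty\}$,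 with $\|\cdot\|_A=\|\cdot\|_{A^{\max}}$ there. **Association.** $A$ and $\alpha$ are associated if, for every finite pointed metric space $X$ and every finite-dimensional Banach space $E$, the map $f\mapsto(u\mapsto u(f))$ is an isometric isomorphism of $A(X,E^*)$ onto $(X\boxtimes_\alpha E)^*$. **Theorem.** Let $A$ be a maximal generic Lipschitz operator Banach ideal and $\alpha$ a finitely generated generic Lipschitz cross-norm which are associated with each other. Then for every pointed metric space $X$ and every Banach space $E$ the relations $$A(X,E^*)=(X\widehat\boxtimes_\alpha E)^*,\qquad A(X,E)=(X\widehat\boxtimes_\alpha E^*)^*\cap\mathrm{Lip}_0(X,E)$$ hold isometrically. That is: * The map sending $f\in A(X,E^*)$ to the continuous extension of $u\mapsto u(f)$ is an isometric isomorphism of $A(X,E^*)$ onto $(X\widehat\boxtimes_\alpha E)^*$. * A map $f\in\mathrm{Lip}_0(X,E)$ belongs to $A(X,E)$ if and only if the functional $u\mapsto u(\kappa_E\circ f)$ on $X\boxtimes E^*$ extends to a continuous linear functional on $X\widehat\boxtimes_\alpha E^*$. In this case the norm of the extension is $\|f\|_A$. -/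

import Mathlib

open Filter Topology
open scoped ENNReal

universe u v

noncomputable section

/-- A pointed metric space: a metric space with a distinguished base point. -/
structure PointedMetricSpace : Type (u + 1) where
  carrier : Type u
  [metric : MetricSpace carrier]
  base : carrier

namespace PointedMetricSpace

instance : CoeSort PointedMetricSpace.{u} (Type u) := ⟨PointedMetricSpace.carrier⟩

instance (X : PointedMetricSpace.{u}) : MetricSpace X := X.metric

/-- A finite subset containing the base point, as a pointed metric space. -/
def sub (X : PointedMetricSpace.{u}) (Y : Finset X) (hY : X.base ∈ Y) : PointedMetricSpace.{u} where
  carrier := {x : X // x ∈ Y}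
  base := ⟨X.base, hY⟩

/-- A base-point preserving Lipschitz map between pointed metric spaces. -/
structure LipMap (X Y : PointedMetricSpace.{u}) : Type u where
  toFun : X → Y
  map_base : toFun X.base = Y.base
  lipschitz : ∃ K : NNReal, LipschitzWith K toFun

/-- The identity of `X`. -/
def LipMap.id (X : PointedMetricSpace.{u}) : LipMap X X :=
  ⟨fun x => x, rfl, 1, LipschitzWith.id⟩

/-- The canonical injection of a finite subset containing the base point. -/
def incl (X : PointedMetricSpace.{u}) (Y : Finset X) (hY : X.base ∈ Y) : LipMap (X.sub Y hY) X :=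
  ⟨Subtype.val, rfl, 1, LipschitzWith.subtype_val _⟩

end PointedMetricSpace

open PointedMetricSpace

/-- The least Lipschitz constant of a Lipschitz map. -/
def lipConst {X : Type*} {Y : Type*} [PseudoMetricSpace X] [PseudoMetricSpace Y] (f : X → Y) : ℝ :=
  sInf {C : ℝ | 0 ≤ C ∧ ∀ x y, dist (f x) (f y) ≤ C * dist x y}

section Lip

variable (𝕜 : Type) [RCLike 𝕜]

/-- The space of Lipschitz maps from `X` to `E` which vanish at the base point. -/
def Lip0 (X : PointedMetricSpace.{u}) (E : Type v) [NormedAddCommGroup E] [NormedSpace 𝕜 E] :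
    Submodule 𝕜 (X → E) where
  carrier := {f | f X.base = 0 ∧ ∃ K : NNReal, LipschitzWith K f}
  zero_mem' := ⟨rfl, 0, LipschitzWith.const 0⟩
  add_mem' := by
    rintro f g ⟨hf, K, hK⟩ ⟨hg, L, hL⟩
    exact ⟨by simp [hf, hg], K + L, hK.add hL⟩
  smul_mem' := by
    rintro c f ⟨hf, K, hK⟩
    exact ⟨by simp [hf], ‖c‖₊ * K, (lipschitzWith_smul c).comp hK⟩

variable {𝕜}
variable {X Y Z : PointedMetricSpace.{u}}
variable {E F : Type v} [NormedAddCommGroup E] [NormedSpace 𝕜 E]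
  [NormedAddCommGroup F] [NormedSpace 𝕜 F]

/-- The composition `S ∘ f ∘ h`, linear in `f`. -/
def Lip0.comp (S : E →L[𝕜] F) (h : LipMap Z X) : Lip0 𝕜 X E →ₗ[𝕜] Lip0 𝕜 Z F where
  toFun f := ⟨fun z => S (f.1 (h.toFun z)), by
    obtain ⟨hf, K, hK⟩ := f.2
    obtain ⟨L, hL⟩ := h.lipschitz
    exact ⟨by simp [h.map_base, hf], _, S.lipschitz.comp (hK.comp hL)⟩⟩
  map_add' f g := by ext z; simp
  map_smul' c f := by ext z; simp

/-- The rank-one operator `g · e : x ↦ g(x) e`. -/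
def Lip0.rankOne (g : Lip0 𝕜 X 𝕜) (e : E) : Lip0 𝕜 X E :=
  ⟨fun x => g.1 x • e, by
    obtain ⟨hg, K, hK⟩ := g.2
    exact ⟨by simp [hg], _, (ContinuousLinearMap.toSpanSingleton 𝕜 e).lipschitz.comp hK⟩⟩

/-- The operator `κ_E ∘ f`, where `κ_E : E → E**` is the canonical injection. -/
def Lip0.toBidual : Lip0 𝕜 X E →ₗ[𝕜] Lip0 𝕜 X (StrongDual 𝕜 (StrongDual 𝕜 E)) :=
  Lip0.comp (NormedSpace.inclusionInDoubleDual 𝕜 E) (LipMap.id X)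

/-- The functional `δ_(x,y) ⊠ e : f ↦ ⟨f(x) - f(y), e⟩` on `Lip_0(X, E*)`. -/
def deltaTensor (x y : X) (e : E) : Module.Dual 𝕜 (Lip0 𝕜 X (StrongDual 𝕜 E)) where
  toFun f := (f.1 x - f.1 y) e
  map_add' f g := by simp; ring
  map_smul' c f := by simp; ring

variable (𝕜 X E) in
/-- The Lipschitz tensor product `X ⊠ E`. -/
def LipTensor : Submodule 𝕜 (Module.Dual 𝕜 (Lip0 𝕜 X (StrongDual 𝕜 E))) :=
  Submodule.span 𝕜 {u | ∃ (x y : X) (e : E), u = deltaTensor x y e}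

/-- `δ_(x,y) ⊠ e` as an element of `X ⊠ E`. -/
def LipTensor.delta (x y : X) (e : E) : LipTensor 𝕜 X E :=
  ⟨deltaTensor x y e, Submodule.subset_span ⟨x, y, e, rfl⟩⟩

/-- The adjoint `T* : F* → E*` of `T : E → F`. -/
def dualOp (T : E →L[𝕜] F) : StrongDual 𝕜 F →L[𝕜] StrongDual 𝕜 E :=
  (ContinuousLinearMap.compL 𝕜 E F 𝕜).flip T

theorem deltaTensor_dualMap (h : LipMap X Y) (T : E →L[𝕜] F) (x y : X) (e : E) :
    (Lip0.comp (dualOp T) h).dualMap (deltaTensor x y e)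
      = deltaTensor (h.toFun x) (h.toFun y) (T e) := by
  ext f
  simp [deltaTensor, Lip0.comp, dualOp]

/-- The linear operator `h ⊠ T : X ⊠ E → Y ⊠ F`, `u ↦ (f ↦ u(T* ∘ f ∘ h))`; it sends
`δ_(x,y) ⊠ e` to `δ_(h(x),h(y)) ⊠ T(e)`, see `LipTensor.map_delta`. -/
def LipTensor.map (h : LipMap X Y) (T : E →L[𝕜] F) : LipTensor 𝕜 X E →ₗ[𝕜] LipTensor 𝕜 Y F :=
  (Lip0.comp (dualOp T) h).dualMap.restrict (p := LipTensor 𝕜 X E) (q := LipTensor 𝕜 Y F) (by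
    intro u hu
    induction hu using Submodule.span_induction with
    | mem u hu =>
      obtain ⟨x, y, e, rfl⟩ := hu
      rw [deltaTensor_dualMap]
      exact Submodule.subset_span ⟨_, _, _, rfl⟩
    | zero => simp
    | add a b _ _ ha hb => rw [map_add]; exact Submodule.add_mem _ ha hb
    | smul c a _ ha => rw [map_smul]; exact Submodule.smul_mem _ c ha)

theorem LipTensor.map_delta (h : LipMap X Y) (T : E →L[𝕜] F) (x y : X) (e : E) :
    LipTensor.map h T (LipTensor.delta x y e)
      = LipTensor.delta (h.toFun x) (h.toFun y) (T e) :=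
  Subtype.ext (deltaTensor_dualMap h T x y e)

end Lip

/-- A generic Lipschitz cross-norm: a norm on `X ⊠ E` for every pointed metric space `X` and every
Banach space `E`, which is a Lipschitz cross-norm, dualizable, and has the metric mapping
property. -/
structure GenericLipCrossNorm (𝕜 : Type) [RCLike 𝕜] where
  norm : ∀ (X : PointedMetricSpace.{u}) (E : Type v) [NormedAddCommGroup E] [NormedSpace 𝕜 E]
    [CompleteSpace E], Seminorm 𝕜 (LipTensor 𝕜 X E)
  eq_zero : ∀ (X : PointedMetricSpace.{u}) (E : Type v) [NormedAddCommGroup E] [NormedSpace 𝕜 E]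
    [CompleteSpace E] (u : LipTensor 𝕜 X E), norm X E u = 0 → u = 0
  cross : ∀ (X : PointedMetricSpace.{u}) (E : Type v) [NormedAddCommGroup E] [NormedSpace 𝕜 E]
    [CompleteSpace E] (x y : X) (e : E), norm X E (LipTensor.delta x y e) = dist x y * ‖e‖
  /- The value of `u = ∑ δ_(x_i,y_i) ⊠ e_i` at `g · φ` is `∑ (g(x_i) - g(y_i)) φ(e_i)`. -/
  dualizable : ∀ (X : PointedMetricSpace.{u}) (E : Type v) [NormedAddCommGroup E] [NormedSpace 𝕜 E]
    [CompleteSpace E] (g : Lip0 𝕜 X 𝕜) (φ : StrongDual 𝕜 E) (u : LipTensor 𝕜 X E),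
    ‖u.1 (Lip0.rankOne g φ)‖ ≤ lipConst g.1 * ‖φ‖ * norm X E u
  metric_mapping : ∀ (X Y : PointedMetricSpace.{u}) (E F : Type v)
    [NormedAddCommGroup E] [NormedSpace 𝕜 E] [CompleteSpace E]
    [NormedAddCommGroup F] [NormedSpace 𝕜 F] [CompleteSpace F]
    (h : LipMap X Y) (T : E →L[𝕜] F) (u : LipTensor 𝕜 X E),
    norm Y F (LipTensor.map h T u) ≤ lipConst h.toFun * ‖T‖ * norm X E u

/-- A generic Lipschitz operator Banach ideal: a linear subspace `A(X, E)` of `Lip_0(X, E)` with a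
norm, for every pointed metric space `X` and every Banach space `E`, subject to the conditions
below. -/
structure GenericLipIdeal (𝕜 : Type) [RCLike 𝕜] where
  carrier : ∀ (X : PointedMetricSpace.{u}) (E : Type v) [NormedAddCommGroup E] [NormedSpace 𝕜 E]
    [CompleteSpace E], Submodule 𝕜 (Lip0 𝕜 X E)
  norm : ∀ (X : PointedMetricSpace.{u}) (E : Type v) [NormedAddCommGroup E] [NormedSpace 𝕜 E]
    [CompleteSpace E], Seminorm 𝕜 (carrier X E)
  eq_zero : ∀ (X : PointedMetricSpace.{u}) (E : Type v) [NormedAddCommGroup E] [NormedSpace 𝕜 E]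
    [CompleteSpace E] (f : carrier X E), norm X E f = 0 → f = 0
  rankOne : ∀ (X : PointedMetricSpace.{u}) (E : Type v) [NormedAddCommGroup E] [NormedSpace 𝕜 E]
    [CompleteSpace E] (g : Lip0 𝕜 X 𝕜) (e : E),
    ∃ hmem : Lip0.rankOne g e ∈ carrier X E, norm X E ⟨_, hmem⟩ ≤ lipConst g.1 * ‖e‖
  lip_le : ∀ (X : PointedMetricSpace.{u}) (E : Type v) [NormedAddCommGroup E] [NormedSpace 𝕜 E]
    [CompleteSpace E] (f : carrier X E), lipConst f.1.1 ≤ norm X E f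
  /- Every Cauchy sequence for the norm of `A(X, E)` converges. -/
  complete : ∀ (X : PointedMetricSpace.{u}) (E : Type v) [NormedAddCommGroup E] [NormedSpace 𝕜 E]
    [CompleteSpace E] (f : ℕ → carrier X E),
    (∀ ε > 0, ∃ N, ∀ m ≥ N, ∀ n ≥ N, norm X E (f m - f n) < ε) →
      ∃ g : carrier X E, Tendsto (fun n => norm X E (f n - g)) atTop (𝓝 0)
  ideal : ∀ (X Z : PointedMetricSpace.{u}) (E F : Type v)
    [NormedAddCommGroup E] [NormedSpace 𝕜 E] [CompleteSpace E]
    [NormedAddCommGroup F] [NormedSpace 𝕜 F] [CompleteSpace F]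
    (f : carrier X E) (h : LipMap Z X) (S : E →L[𝕜] F),
    ∃ hmem : Lip0.comp S h f.1 ∈ carrier Z F,
      norm Z F ⟨_, hmem⟩ ≤ ‖S‖ * norm X E f * lipConst h.toFun

section Generic

variable {𝕜 : Type} [RCLike 𝕜]

namespace GenericLipCrossNorm

variable (α : GenericLipCrossNorm.{u, v} 𝕜)
variable (X : PointedMetricSpace.{u}) (E : Type v) [NormedAddCommGroup E] [NormedSpace 𝕜 E]
  [CompleteSpace E]

/-- The space `X ⊠_α E`, that is, `X ⊠ E` with the norm `α`. -/
def Space (_ : GenericLipCrossNorm.{u, v} 𝕜) (X : PointedMetricSpace.{u}) (E : Type v)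
    [NormedAddCommGroup E] [NormedSpace 𝕜 E] [CompleteSpace E] : Type (max u v) :=
  LipTensor 𝕜 X E

instance : NormedAddCommGroup (α.Space X E) :=
  AddGroupNorm.toNormedAddCommGroup (E := LipTensor 𝕜 X E)
    { (α.norm X E).toAddGroupSeminorm with
      eq_zero_of_map_eq_zero' := α.eq_zero X E }

instance : Module 𝕜 (α.Space X E) := inferInstanceAs (Module 𝕜 (LipTensor 𝕜 X E))

instance : NormedSpace 𝕜 (α.Space X E) where
  norm_smul_le c u := (map_smul_eq_mul (α.norm X E) c u).le

/-- The element `u` of `X ⊠ E`, seen in `X ⊠_α E`. -/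
def toSpace (u : LipTensor 𝕜 X E) : α.Space X E := u

/-- `α` is finitely generated: `α(u; X, E)` is the infimum of `α(u; X₀, E₀)` over all finite
`X₀ ⊆ X` containing the base point and all finite-dimensional subspaces `E₀ ⊆ E` such that
`u ∈ X₀ ⊠ E₀`, where `X₀ ⊠ E₀` is regarded as a subset of `X ⊠ E` via the canonical injections. -/
def IsFinitelyGenerated : Prop :=
  ∀ (X : PointedMetricSpace.{u}) (E : Type v) [NormedAddCommGroup E] [NormedSpace 𝕜 E]
    [CompleteSpace E] (u : LipTensor 𝕜 X E),
    IsGLB {r : ℝ | ∃ (X₀ : Finset X) (hX₀ : X.base ∈ X₀) (E₀ : Submodule 𝕜 E)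
        (_ : FiniteDimensional 𝕜 E₀) (u₀ : LipTensor 𝕜 (X.sub X₀ hX₀) E₀),
        LipTensor.map (X.incl X₀ hX₀) E₀.subtypeL u₀ = u ∧
        haveI : CompleteSpace E₀ := FiniteDimensional.complete 𝕜 E₀
        r = α.norm (X.sub X₀ hX₀) E₀ u₀}
      (α.norm X E u)

end GenericLipCrossNorm

namespace GenericLipIdeal

variable (A : GenericLipIdeal.{u, v} 𝕜)
variable (X : PointedMetricSpace.{u}) (E : Type v) [NormedAddCommGroup E] [NormedSpace 𝕜 E]
  [CompleteSpace E]

/-- The Banach space `A(X, E)`, that is, the subspace `A(X, E)` of `Lip_0(X, E)` with the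
norm `‖·‖_A`. -/
def Space : Type (max u v) := A.carrier X E

instance : NormedAddCommGroup (A.Space X E) :=
  AddGroupNorm.toNormedAddCommGroup (E := A.carrier X E)
    { (A.norm X E).toAddGroupSeminorm with
      eq_zero_of_map_eq_zero' := A.eq_zero X E }

instance : Module 𝕜 (A.Space X E) := inferInstanceAs (Module 𝕜 (A.carrier X E))

instance : NormedSpace 𝕜 (A.Space X E) where
  norm_smul_le c f := (map_smul_eq_mul (A.norm X E) c f).le

variable {A X E} in
/-- The Lipschitz operator underlying an element of `A(X, E)`. -/
def Space.toLip0 (f : A.Space X E) : Lip0 𝕜 X E := Subtype.val f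

open Classical in
variable {X E} in
/-- `‖f‖_A` as an extended number, with value `∞` when `f` is not in `A(X, E)`. -/
def extNorm (f : Lip0 𝕜 X E) : ℝ≥0∞ :=
  if hf : f ∈ A.carrier X E then ENNReal.ofReal (A.norm X E ⟨f, hf⟩) else ∞

variable {X E} in
/-- `‖f‖_{A^max}`: the supremum of `‖Q_L ∘ f ∘ I_Y‖_A` over all finite `Y ⊆ X` containing the base
point and all closed subspaces `L ⊆ E` of finite codimension. -/
def maxNorm (f : Lip0 𝕜 X E) : ℝ≥0∞ :=
  ⨆ (Y : Finset X) (hY : X.base ∈ Y) (L : Submodule 𝕜 E) (_ : IsClosed (L : Set E))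
    (_ : FiniteDimensional 𝕜 (E ⧸ L)),
    A.extNorm (Lip0.comp L.mkQL (X.incl Y hY) f)

/-- `A` is maximal: `A(X, E) = A^max(X, E)`, with equal norms, for all `X` and `E`. -/
def IsMaximal : Prop :=
  ∀ (X : PointedMetricSpace.{u}) (E : Type v) [NormedAddCommGroup E] [NormedSpace 𝕜 E]
    [CompleteSpace E],
    (∀ f : Lip0 𝕜 X E, f ∈ A.carrier X E ↔ A.maxNorm f < ∞) ∧
    ∀ f : A.carrier X E, ENNReal.ofReal (A.norm X E f) = A.maxNorm f.1

end GenericLipIdeal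

/-- `A` and `α` are associated: `A(X, E*) = (X ⊠_α E)*` holds isometrically, via the canonical map
which sends `f` to the functional `u ↦ u(f)`, for all finite `X` and finite-dimensional `E`. -/
def AreAssociated (A : GenericLipIdeal.{u, v} 𝕜) (α : GenericLipCrossNorm.{u, v} 𝕜) : Prop :=
  ∀ (X : PointedMetricSpace.{u}) (E : Type v) [NormedAddCommGroup E] [NormedSpace 𝕜 E]
    [CompleteSpace E] [Finite X] [FiniteDimensional 𝕜 E],
    ∃ Φ : A.Space X (StrongDual 𝕜 E) ≃ₗᵢ[𝕜] StrongDual 𝕜 (α.Space X E),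
      ∀ (f : A.Space X (StrongDual 𝕜 E)) (u : LipTensor 𝕜 X E),
        Φ f (α.toSpace X E u) = u.1 f.toLip0

end Generic

end

/-!
Write `‖f‖_A` and `‖f‖_α` for the norm of `f : X → E*` in `A(X, E*)` and for its norm as a
functional on `X ⊠_α E`, both with value `∞` where they do not exist; the point is that they agree.
Finite generation of `α` means that `‖f‖_α` is determined by the restrictions of `f` to finite
`Y ⊆ X` and finite-dimensional `G ⊆ E`, where association turns it into an `A`-norm and the ideal
property bounds it by `‖f‖_A`. Conversely, maximality means that `‖f‖_A` is determined by the maps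
`Q f|_Y` with `Y` finite and `Q : E* → Q₀` a finite-dimensional quotient. Here `Q*` takes values in
`E**`, not in `E`, but by local reflexivity it agrees on the span of `f(Y)` with an operator
`T : Q₀* → E` of norm less than any given `K > 1`, so that `Q f|_Y` becomes `T* f|_Y` and
association applies again.

A maximal ideal is regular: `‖κ_E f‖_A = ‖f‖_A`, since every finite-dimensional quotient map of `E`
extends to `E**` without increase of the norm. This identifies `Q f|_Y` with a map into `Q₀**`
above, and it reduces the relation for `A(X, E)` to the one for `A(X, E**)`.
-/

-- The instances on iterated duals are found only at this depth.
set_option maxSynthPendingDepth 3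

open PointedMetricSpace

section Helly

variable {𝕜 : Type*} [RCLike 𝕜] {E : Type*} [SeminormedAddCommGroup E] [NormedSpace 𝕜 E]

theorem exists_forall_apply_eq_of_finiteDimensional (M : Submodule 𝕜 (StrongDual 𝕜 E))
    [FiniteDimensional 𝕜 M] (z : Module.Dual 𝕜 M) : ∃ e : E, ∀ φ : M, φ.1 e = z φ := by
  let coe : M →ₗ[𝕜] Module.Dual 𝕜 E := ContinuousLinearMap.coeLM 𝕜 ∘ₗ M.subtype
  have coe_injective : Function.Injective coe :=
    ContinuousLinearMap.coe_injective.comp Subtype.val_injective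
  let toRange := LinearEquiv.ofInjective coe coe_injective
  obtain ⟨q, hq⟩ := (Subspace.quotDualCoannihilatorToDual_bijective coe.range).surjective
    (z ∘ₗ toRange.symm.toLinearMap)
  obtain ⟨e, rfl⟩ := Submodule.mkQ_surjective _ q
  refine ⟨e, fun φ => ?_⟩
  simpa using! DFunLike.congr_fun hq (toRange φ)

theorem norm_mkQL_le (N : Submodule 𝕜 E) : ‖N.mkQL‖ ≤ 1 :=
  ContinuousLinearMap.opNorm_le_bound _ zero_le_one fun e => by
    simpa using Submodule.Quotient.norm_mk_le N e

theorem exists_norm_lt_forall_apply_eq_of_finiteDimensional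
    (z : StrongDual 𝕜 (StrongDual 𝕜 E)) {K : ℝ} (hz : ‖z‖ < K)
    (M : Submodule 𝕜 (StrongDual 𝕜 E)) [FiniteDimensional 𝕜 M] :
    ∃ e : E, ‖e‖ < K ∧ ∀ φ ∈ M, φ e = z φ := by
  obtain ⟨e₀, he₀⟩ := exists_forall_apply_eq_of_finiteDimensional M (z.toLinearMap ∘ₗ M.subtype)
  let W : Submodule 𝕜 (Module.Dual 𝕜 E) := M.map (ContinuousLinearMap.coeLM 𝕜)
  let N : Submodule 𝕜 E := W.dualCoannihilator
  -- `N` is the common kernel of `M`, so a norming functional of `e₀` modulo `N` comes from `M`,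
  -- where evaluation at `e₀` is `z`.
  obtain ⟨ψ, hψ, hψe₀⟩ := exists_dual_vector'' 𝕜 (N.mkQ e₀)
  have hψM : ψ.comp N.mkQL ∈ M := by
    have : (ψ.comp N.mkQL).toLinearMap ∈ N.dualAnnihilator := by
      rw [Submodule.mem_dualAnnihilator]
      intro x hx
      simpa using congrArg ψ ((Submodule.Quotient.mk_eq_zero N).2 hx)
    rw [Subspace.dualCoannihilator_dualAnnihilator_eq] at this
    obtain ⟨φ, hφ, hφψ⟩ := this
    rwa [← ContinuousLinearMap.coe_injective hφψ]
  have norm_mk_le : ‖N.mkQ e₀‖ ≤ ‖z‖ := calc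
    ‖N.mkQ e₀‖ = ‖ψ (N.mkQ e₀)‖ := by rw [hψe₀]; simp
    _ = ‖z (ψ.comp N.mkQL)‖ := congrArg norm (he₀ ⟨_, hψM⟩)
    _ ≤ ‖z‖ * 1 := z.le_of_opNorm_le_of_le le_rfl <|
        (ψ.opNorm_comp_le _).trans (mul_le_one₀ hψ (norm_nonneg _) (norm_mkQL_le N))
    _ = ‖z‖ := mul_one _
  obtain ⟨e, he, hlt⟩ := Submodule.Quotient.norm_mk_lt (N.mkQ e₀) (sub_pos.2 hz)
  have sub_mem : e - e₀ ∈ N := (Submodule.Quotient.eq N).1 he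
  refine ⟨e, by linarith, fun φ hφ => ?_⟩
  calc φ e = φ e₀ := by
        rw [← sub_eq_zero, ← map_sub]
        exact (Submodule.mem_dualCoannihilator _).1 sub_mem _ ⟨φ, hφ, rfl⟩
    _ = z φ := he₀ ⟨φ, hφ⟩

end Helly

section Extension

variable {𝕜 : Type*} [RCLike 𝕜]

theorem exists_norm_le_comp_eq_of_bound {V P : Type*} [AddCommGroup V] [Module 𝕜 V]
    [SeminormedAddCommGroup P] [NormedSpace 𝕜 P] (j : V →ₗ[𝕜] P) (Λ : V →ₗ[𝕜] 𝕜) {C : ℝ}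
    (hC : 0 ≤ C) (hΛ : ∀ v, ‖Λ v‖ ≤ C * ‖j v‖) :
    ∃ ψ : StrongDual 𝕜 P, ‖ψ‖ ≤ C ∧ ∀ v, ψ (j v) = Λ v := by
  have hlift (v : V) : Λ.compLeftInverse j ⟨j v, v, rfl⟩ = Λ v :=
    LinearMap.compLeftInverse_apply_of_bdd Λ j ⟨C, hΛ⟩ v _ rfl
  obtain ⟨ψ, hψ, hnorm⟩ := exists_extension_norm_eq j.range (Λ.compLeftInverse j)
  refine ⟨ψ, ?_, fun v => (hψ ⟨j v, v, rfl⟩).trans (hlift v)⟩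
  rw [hnorm]
  refine ContinuousLinearMap.opNorm_le_bound _ hC ?_
  rintro ⟨_, v, rfl⟩
  rw [hlift]
  exact hΛ v

theorem exists_finset_forall_norm_le (𝕜 : Type*) [RCLike 𝕜] (G : Type*) [NormedAddCommGroup G]
    [NormedSpace 𝕜 G] [FiniteDimensional 𝕜 G] {K : ℝ} (hK : 1 < K) :
    ∃ t : Finset G, (∀ g ∈ t, ‖g‖ ≤ 1) ∧
      ∀ {E : Type*} [SeminormedAddCommGroup E] [NormedSpace 𝕜 E] (T : G →L[𝕜] E),
        ‖T‖ ≤ K * ‖fun g : t => T g‖ := by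
  have := FiniteDimensional.proper_rclike 𝕜 G
  have hK₀ : 0 < K := zero_lt_one.trans hK
  obtain ⟨t, ht, htfin, hcover⟩ := finite_cover_balls_of_compact
    (isCompact_closedBall (0 : G) 1) (sub_pos.2 (inv_lt_one_of_one_lt₀ hK))
  lift t to Finset G using htfin
  refine ⟨t, fun g hg => by simpa using ht hg, fun T => ?_⟩
  set c : ℝ := ‖fun g : t => T g‖
  have hball (g : G) (hg : ‖g‖ ≤ 1) : ‖T g‖ ≤ c + ‖T‖ * (1 - K⁻¹) := by
    obtain ⟨g', hg', hgg'⟩ := Set.mem_iUnion₂.1 (hcover (mem_closedBall_zero_iff.2 hg))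
    calc ‖T g‖ = ‖T g' + T (g - g')‖ := by simp
      _ ≤ ‖T g'‖ + ‖T (g - g')‖ := norm_add_le _ _
      _ ≤ c + ‖T‖ * (1 - K⁻¹) := add_le_add (norm_le_pi_norm (fun g : t => T g) ⟨g', hg'⟩)
          (T.le_opNorm_of_le (mem_ball_iff_norm.1 hgg').le)
  have hself : ‖T‖ ≤ c + ‖T‖ * (1 - K⁻¹) :=
    ContinuousLinearMap.opNorm_le_of_unit_norm ((norm_nonneg _).trans (hball 0 (by simp)))
      fun g hg => hball g hg.le
  have : K⁻¹ * ‖T‖ ≤ c := by linarith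
  rwa [inv_mul_le_iff₀ hK₀] at this

end Extension

section LocalReflexivity

variable {𝕜 : Type*} [RCLike 𝕜] {E G : Type*} [NormedAddCommGroup E] [NormedSpace 𝕜 E]

theorem norm_sum_apply_comp_single_le {ι : Type*} [Fintype ι] [DecidableEq ι]
    (z : ι → StrongDual 𝕜 (StrongDual 𝕜 E)) {C : ℝ} (hz : ∀ i, ‖z i‖ ≤ C)
    (hC : 0 ≤ C) (χ : StrongDual 𝕜 (ι → E)) :
    ‖∑ i, z i (χ.comp (.single 𝕜 (fun _ => E) i))‖ ≤ ‖χ‖ * C := by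
  have norm_apply_single_le {K : ℝ} (hK : C < K) :
      ‖∑ i, z i (χ.comp (.single 𝕜 (fun _ => E) i))‖ ≤ ‖χ‖ * K := by
    choose e he hze using fun i => exists_norm_lt_forall_apply_eq_of_finiteDimensional
      (z i) ((hz i).trans_lt hK) (𝕜 ∙ χ.comp (.single 𝕜 (fun _ => E) i))
    calc ‖∑ i, z i (χ.comp (.single 𝕜 (fun _ => E) i))‖ = ‖χ e‖ := by
          rw [← χ.sum_comp_single]
          exact congrArg norm <| Finset.sum_congr rfl fun i _ =>
            (hze i _ (Submodule.mem_span_singleton_self _)).symm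
      _ ≤ ‖χ‖ * K := χ.le_opNorm_of_le <|
        (pi_norm_le_iff_of_nonneg (hC.trans hK.le)).2 fun i => (he i).le
  have tendsto_mul : Tendsto (fun K => ‖χ‖ * K) (𝓝[>] C) (𝓝 (‖χ‖ * C)) :=
    (continuous_const_mul ‖χ‖).continuousWithinAt
  exact ge_of_tendsto tendsto_mul (eventually_mem_nhdsWithin.mono fun K => norm_apply_single_le)

variable [NormedAddCommGroup G] [NormedSpace 𝕜 G] [FiniteDimensional 𝕜 G]

theorem exists_linearMap_apply_comp_apply_eq (J : G →L[𝕜] StrongDual 𝕜 (StrongDual 𝕜 E)) :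
    ∃ Z : StrongDual 𝕜 (G →L[𝕜] E) →ₗ[𝕜] 𝕜,
      ∀ (φ : StrongDual 𝕜 E) (g : G), Z (φ.comp (.apply 𝕜 E g)) = J g φ := by
  let b := Module.finBasis 𝕜 G
  let ξ (k) : StrongDual 𝕜 G := (b.coord k).toContinuousLinearMap
  refine ⟨∑ k, (J (b k)).toLinearMap ∘ₗ
    ((ContinuousLinearMap.smulRightL 𝕜 G E (ξ k)).precomp 𝕜).toLinearMap, fun φ g => ?_⟩
  have smulRight_eq (k) : (φ.comp (.apply 𝕜 E g)).comp
      (ContinuousLinearMap.smulRightL 𝕜 G E (ξ k)) = ξ k g • φ := by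
    ext e
    simp
  have apply_eq_sum : J g φ = ∑ k, ξ k g • J (b k) φ := by
    conv_lhs => rw [← b.sum_repr g, map_sum]
    simp [ξ]
  simp [smulRight_eq, apply_eq_sum]

theorem exists_norm_le_apply_comp_apply_eq (J : G →L[𝕜] StrongDual 𝕜 (StrongDual 𝕜 E)) :
    ∃ Z : StrongDual 𝕜 (StrongDual 𝕜 (G →L[𝕜] E)), ‖Z‖ ≤ ‖J‖ ∧
      ∀ (φ : StrongDual 𝕜 E) (g : G), Z (φ.comp (.apply 𝕜 E g)) = J g φ := by
  classical
  obtain ⟨Z, hZ⟩ := exists_linearMap_apply_comp_apply_eq J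
  suffices bound : ∀ Λ, ‖Z Λ‖ ≤ ‖J‖ * ‖Λ‖ from
    ⟨Z.mkContinuous ‖J‖ bound, Z.mkContinuous_norm_le (norm_nonneg J) bound, hZ⟩
  refine fun Λ => (le_iff_forall_one_lt_le_mul₀ (by positivity)).2 fun K hK => ?_
  obtain ⟨t, ht, hnorming⟩ := exists_finset_forall_norm_le 𝕜 G hK
  -- Up to the factor `K`, the norm of `G →L E` is that of `ℓ^∞(t, E)`; hence `Λ` is a sum of
  -- evaluations at the points of `t`, and `Z Λ` involves only the values `J g` with `g ∈ t`.
  let restrict : (G →L[𝕜] E) →ₗ[𝕜] (t → E) :=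
    LinearMap.pi fun g => (ContinuousLinearMap.apply 𝕜 E g.1).toLinearMap
  obtain ⟨ψ, hψ, hψΛ⟩ := exists_norm_le_comp_eq_of_bound restrict Λ.toLinearMap (C := ‖Λ‖ * K)
    (by positivity) fun T => by
      rw [mul_assoc]
      exact Λ.le_of_opNorm_le_of_le le_rfl (hnorming T)
  have Λ_eq : Λ = ∑ g : t, (ψ.comp (.single 𝕜 (fun _ : t => E) g)).comp (.apply 𝕜 E g.1) := by
    ext T
    rw [← ContinuousLinearMap.coe_coe Λ, ← hψΛ, ← Finset.univ_sum_single (restrict T)]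
    simp [restrict]
  calc ‖Z Λ‖ = ‖∑ g : t, J g.1 (ψ.comp (.single 𝕜 (fun _ : t => E) g))‖ := by
        conv_lhs => rw [Λ_eq]
        simp only [map_sum, hZ]
    _ ≤ ‖ψ‖ * ‖J‖ := norm_sum_apply_comp_single_le (fun g : t => J g)
        (fun g => (J.le_opNorm_of_le (ht g g.2)).trans_eq (mul_one _)) (norm_nonneg J) ψ
    _ ≤ ‖Λ‖ * K * ‖J‖ := by gcongr
    _ = ‖J‖ * ‖Λ‖ * K := by ring

/-- The part of the principle of local reflexivity without a lower bound on `T`, proved by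
applying Helly's theorem in `G →L[𝕜] E` to an element of its bidual representing `J`. -/
theorem exists_norm_lt_forall_apply_apply_eq (J : G →L[𝕜] StrongDual 𝕜 (StrongDual 𝕜 E)) {K : ℝ}
    (hK : ‖J‖ < K) (M : Submodule 𝕜 (StrongDual 𝕜 E)) [FiniteDimensional 𝕜 M] :
    ∃ T : G →L[𝕜] E, ‖T‖ < K ∧ ∀ φ ∈ M, ∀ g, φ (T g) = J g φ := by
  obtain ⟨Z, hZ, hZJ⟩ := exists_norm_le_apply_comp_apply_eq J
  let evalComp : StrongDual 𝕜 E →ₗ[𝕜] G →ₗ[𝕜] StrongDual 𝕜 (G →L[𝕜] E) :=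
    LinearMap.mk₂ 𝕜 (fun φ g => φ.comp (.apply 𝕜 E g))
      (fun _ _ _ => by ext; simp) (fun _ _ _ => by ext; simp)
      (fun _ _ _ => by ext; simp) (fun _ _ _ => by ext; simp)
  let N := Submodule.map₂ evalComp M ⊤
  have : FiniteDimensional 𝕜 N :=
    .of_fg (Submodule.FG.map₂ evalComp (Module.Finite.iff_fg.1 inferInstance) Module.Finite.fg_top)
  obtain ⟨T, hT, hTZ⟩ :=
    exists_norm_lt_forall_apply_eq_of_finiteDimensional Z (hZ.trans_lt hK) N
  exact ⟨T, hT, fun φ hφ g =>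
    (hTZ _ (Submodule.apply_mem_map₂ evalComp hφ Submodule.mem_top)).trans (hZJ φ g)⟩

end LocalReflexivity

section FiniteDimensionalBidual

variable (𝕜 : Type*) [RCLike 𝕜] (E : Type*) [NormedAddCommGroup E] [NormedSpace 𝕜 E]

theorem finrank_strongDual_eq [FiniteDimensional 𝕜 E] :
    Module.finrank 𝕜 (StrongDual 𝕜 E) = Module.finrank 𝕜 E :=
  (LinearMap.toContinuousLinearMap (E := E) (F' := 𝕜)).finrank_eq.symm.trans
    Subspace.dual_finrank_eq

theorem exists_leftInverse_inclusionInDoubleDual [FiniteDimensional 𝕜 E] :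
    ∃ R : StrongDual 𝕜 (StrongDual 𝕜 E) →L[𝕜] E,
      ‖R‖ ≤ 1 ∧ ∀ e, R (NormedSpace.inclusionInDoubleDual 𝕜 E e) = e := by
  let κ : E ≃ₗᵢ[𝕜] StrongDual 𝕜 (StrongDual 𝕜 E) :=
    (NormedSpace.inclusionInDoubleDualLi 𝕜).toLinearIsometryEquiv
      ((finrank_strongDual_eq 𝕜 _).trans (finrank_strongDual_eq 𝕜 _)).symm
  exact ⟨κ.symm.toContinuousLinearEquiv, κ.symm.toLinearIsometry.norm_toContinuousLinearMap_le,
    κ.symm_apply_apply⟩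

end FiniteDimensionalBidual

section DualOfCompletion

open UniformSpace (Completion)
open UniformSpace.Completion (toComplL denseRange_coe isUniformInducing_coe)

variable {𝕜 : Type*} [RCLike 𝕜] {S : Type*} [NormedAddCommGroup S] [NormedSpace 𝕜 S]

theorem extend_comp_toComplL (ψ : StrongDual 𝕜 (Completion S)) :
    (ψ.comp toComplL).extend toComplL = ψ :=
  ContinuousLinearMap.extend_unique (e := toComplL) _ denseRange_coe
    (isUniformInducing_coe S) ψ rfl

theorem norm_comp_toComplL (ψ : StrongDual 𝕜 (Completion S)) : ‖ψ.comp toComplL‖ = ‖ψ‖ := by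
  refine le_antisymm ?_ ?_
  · exact ContinuousLinearMap.opNorm_le_bound _ (norm_nonneg ψ) fun s =>
      ψ.le_opNorm_of_le (Completion.norm_coe s).le
  · simpa [extend_comp_toComplL] using (ψ.comp toComplL).opNorm_extend_le (e := toComplL)
      denseRange_coe (N := 1) fun s => by simp

variable (𝕜 S) in
/-- The dual of a normed space, identified with the dual of its completion by continuous extension;
the inverse is restriction. -/
noncomputable def dualCompletionEquiv :
    StrongDual 𝕜 S ≃ₗᵢ[𝕜] StrongDual 𝕜 (Completion S) :=
  (LinearIsometryEquiv.ofSurjective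
    ⟨(ContinuousLinearMap.precomp 𝕜 toComplL).toLinearMap, norm_comp_toComplL⟩
    fun φ => ⟨φ.extend toComplL, ContinuousLinearMap.ext <|
      φ.extend_eq (e := toComplL) denseRange_coe (isUniformInducing_coe S)⟩).symm

@[simp] theorem dualCompletionEquiv_symm_apply (ψ : StrongDual 𝕜 (Completion S)) (s : S) :
    (dualCompletionEquiv 𝕜 S).symm ψ s = ψ s :=
  rfl

@[simp] theorem dualCompletionEquiv_apply_coe (φ : StrongDual 𝕜 S) (s : S) :
    dualCompletionEquiv 𝕜 S φ s = φ s := by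
  rw [← dualCompletionEquiv_symm_apply, LinearIsometryEquiv.symm_apply_apply]

end DualOfCompletion

section LipschitzTensor

variable {𝕜 : Type} [RCLike 𝕜] {X Y Z : PointedMetricSpace.{u}} {E F : Type v}
  [NormedAddCommGroup E] [NormedSpace 𝕜 E] [NormedAddCommGroup F] [NormedSpace 𝕜 F]

theorem lipConst_le_one {P Q : Type*} [PseudoMetricSpace P] [PseudoMetricSpace Q] {f : P → Q}
    (hf : LipschitzWith 1 f) : lipConst f ≤ 1 :=
  csInf_le ⟨0, fun _ hC => hC.1⟩ ⟨zero_le_one, hf.dist_le_mul⟩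

theorem lipschitzWith_incl (Y : Finset X) (hY : X.base ∈ Y) :
    LipschitzWith 1 (X.incl Y hY).toFun :=
  LipschitzWith.subtype_val _

theorem norm_dualOp_le (T : E →L[𝕜] F) : ‖dualOp T‖ ≤ ‖T‖ :=
  ContinuousLinearMap.opNorm_le_bound _ (norm_nonneg T) fun φ =>
    (φ.opNorm_comp_le T).trans_eq (mul_comm _ _)

namespace LipTensor

/-- The functional `u ↦ u(f)` on `X ⊠ E` given by a Lipschitz map `f : X → E*`. -/
noncomputable def evalAt (f : Lip0 𝕜 X (StrongDual 𝕜 E)) : LipTensor 𝕜 X E →ₗ[𝕜] 𝕜 :=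
  Module.Dual.eval 𝕜 _ f ∘ₗ (LipTensor 𝕜 X E).subtype

theorem evalAt_delta (f : Lip0 𝕜 X (StrongDual 𝕜 E)) (x y : X) (e : E) :
    evalAt f (delta x y e) = (f.1 x - f.1 y) e :=
  rfl

theorem evalAt_injective :
    Function.Injective (evalAt : Lip0 𝕜 X (StrongDual 𝕜 E) → LipTensor 𝕜 X E →ₗ[𝕜] 𝕜) := by
  intro f g hfg
  ext x e
  simpa [evalAt_delta, f.2.1, g.2.1] using LinearMap.congr_fun hfg (delta x X.base e)

theorem linearMap_ext {φ ψ : LipTensor 𝕜 X E →ₗ[𝕜] 𝕜}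
    (h : ∀ x y e, φ (delta x y e) = ψ (delta x y e)) : φ = ψ := by
  refine LinearMap.ext_on Submodule.span_span_coe_preimage ?_
  rintro ⟨_, _⟩ ⟨x, y, e, rfl⟩
  exact h x y e

/-- The tensor `δ_(x,y) ⊠ e` as a linear function of `e`. -/
def deltaLinear (x y : X) : E →ₗ[𝕜] LipTensor 𝕜 X E where
  toFun := delta x y
  map_add' e e' := by ext f; exact map_add (f.1 x - f.1 y) e e'
  map_smul' c e := by ext f; exact map_smul (f.1 x - f.1 y) c e

theorem delta_sub_delta_base (x y : X) (e : E) :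
    (delta x X.base e - delta y X.base e : LipTensor 𝕜 X E) = delta x y e := by
  ext f
  simp [delta, deltaTensor]

theorem exists_evalAt_eq_of_bound (φ : LipTensor 𝕜 X E →ₗ[𝕜] 𝕜) {C : NNReal}
    (hφ : ∀ x y e, ‖φ (delta x y e)‖ ≤ C * (dist x y * ‖e‖)) :
    ∃ f : Lip0 𝕜 X (StrongDual 𝕜 E), evalAt f = φ := by
  let f (x : X) : StrongDual 𝕜 E := (φ ∘ₗ deltaLinear x X.base).mkContinuous (C * dist x X.base)
    fun e => (hφ x X.base e).trans_eq (mul_assoc _ _ _).symm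
  have f_sub (x y : X) (e : E) : (f x - f y) e = φ (delta x y e) :=
    (map_sub φ _ _).symm.trans (congrArg φ (delta_sub_delta_base x y e))
  have f_base : f X.base = 0 := by
    ext e
    simpa [f, deltaLinear] using hφ X.base X.base e
  have f_lipschitz : LipschitzWith C f := LipschitzWith.of_dist_le_mul fun x y => by
    rw [dist_eq_norm]
    refine ContinuousLinearMap.opNorm_le_bound _ (by positivity) fun e => ?_
    rw [f_sub, mul_assoc]
    exact hφ x y e
  exact ⟨⟨f, f_base, C, f_lipschitz⟩, linearMap_ext f_sub⟩

end LipTensor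

theorem exists_comp_dualOp_eq_toBidual_comp (f : Lip0 𝕜 X (StrongDual 𝕜 E)) (Y : Finset X)
    (hY : X.base ∈ Y) {Q : Type v} [NormedAddCommGroup Q] [NormedSpace 𝕜 Q]
    [FiniteDimensional 𝕜 Q] {q : StrongDual 𝕜 E →L[𝕜] Q} (hq : ‖q‖ ≤ 1) {K : ℝ} (hK : 1 < K) :
    ∃ T : StrongDual 𝕜 Q →L[𝕜] E, ‖T‖ < K ∧
      Lip0.comp (dualOp T) (X.incl Y hY) f = Lip0.toBidual (Lip0.comp q (X.incl Y hY) f) := by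
  have : FiniteDimensional 𝕜 (Submodule.span 𝕜 (f.1 '' Y)) :=
    .span_of_finite 𝕜 (Y.finite_toSet.image f.1)
  obtain ⟨T, hT, hTf⟩ := exists_norm_lt_forall_apply_apply_eq (dualOp q)
    (((norm_dualOp_le q).trans hq).trans_lt hK) (Submodule.span 𝕜 (f.1 '' Y))
  refine ⟨T, hT, ?_⟩
  ext y g
  exact hTf _ (Submodule.subset_span ⟨y.1, y.2, rfl⟩) g

end LipschitzTensor

section DualNorm

variable {𝕜 : Type} [RCLike 𝕜] {X Y : PointedMetricSpace.{u}}
  {E F : Type v} [NormedAddCommGroup E] [NormedSpace 𝕜 E] [CompleteSpace E]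
  [NormedAddCommGroup F] [NormedSpace 𝕜 F] [CompleteSpace F]

namespace GenericLipCrossNorm

variable (α : GenericLipCrossNorm.{u, v} 𝕜)

/-- The norm of `u ↦ u(f)` as a functional on `X ⊠_α E`, with value `∞` when this functional is
unbounded. The tensor `u = 0` contributes `0 / 0 = 0` to the supremum. -/
noncomputable def dualNorm (f : Lip0 𝕜 X (StrongDual 𝕜 E)) : ℝ≥0∞ :=
  ⨆ u : LipTensor 𝕜 X E, ‖u.1 f‖ₑ / ‖α.toSpace X E u‖ₑ

variable {α}

theorem dualNorm_le_iff {f : Lip0 𝕜 X (StrongDual 𝕜 E)} {c : ℝ≥0∞} :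
    α.dualNorm f ≤ c ↔ ∀ u : LipTensor 𝕜 X E, ‖u.1 f‖ₑ ≤ c * ‖α.toSpace X E u‖ₑ := by
  refine iSup_le_iff.trans (forall_congr' fun u => ?_)
  obtain rfl | hu := eq_or_ne u 0
  · simp
  · exact ENNReal.div_le_iff_le_mul (.inl (enorm_ne_zero.2 hu)) (.inl enorm_ne_top)

theorem enorm_apply_le_dualNorm_mul (f : Lip0 𝕜 X (StrongDual 𝕜 E)) (u : LipTensor 𝕜 X E) :
    ‖u.1 f‖ₑ ≤ α.dualNorm f * ‖α.toSpace X E u‖ₑ :=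
  dualNorm_le_iff.1 le_rfl u

theorem dualNorm_le_coe_iff {f : Lip0 𝕜 X (StrongDual 𝕜 E)} {c : NNReal} :
    α.dualNorm f ≤ c ↔ ∀ u : LipTensor 𝕜 X E, ‖u.1 f‖ ≤ c * α.norm X E u := by
  refine dualNorm_le_iff.trans (forall_congr' fun u => ?_)
  simp only [enorm_eq_nnnorm]
  norm_cast

theorem dualNorm_eq_enorm {f : Lip0 𝕜 X (StrongDual 𝕜 E)} {φ : StrongDual 𝕜 (α.Space X E)}
    (hφ : ∀ u, φ (α.toSpace X E u) = u.1 f) : α.dualNorm f = ‖φ‖ₑ :=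
  eq_of_forall_ge_iff fun c => by
    simp only [dualNorm_le_iff, ContinuousLinearMap.opENorm_le_iff, ← hφ]
    rfl

theorem dualNorm_lt_top_iff {f : Lip0 𝕜 X (StrongDual 𝕜 E)} :
    α.dualNorm f < ∞ ↔ ∃ φ : StrongDual 𝕜 (α.Space X E), ∀ u, φ (α.toSpace X E u) = u.1 f := by
  refine ⟨fun hf => ?_, fun ⟨φ, hφ⟩ => by rw [dualNorm_eq_enorm hφ]; exact enorm_lt_top⟩
  lift α.dualNorm f to NNReal using hf.ne with c hc
  exact ⟨LinearMap.mkContinuous (E := α.Space X E) (LipTensor.evalAt f) c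
    (dualNorm_le_coe_iff.1 hc.ge), fun _ => rfl⟩

theorem dualNorm_comp_le {h : LipMap X Y} (hh : LipschitzWith 1 h.toFun) (T : E →L[𝕜] F)
    (f : Lip0 𝕜 Y (StrongDual 𝕜 F)) :
    α.dualNorm (Lip0.comp (dualOp T) h f) ≤ ‖T‖ₑ * α.dualNorm f := by
  refine dualNorm_le_iff.2 fun u => ?_
  have enorm_map_le : ‖α.toSpace Y F (LipTensor.map h T u)‖ₑ ≤ ‖T‖ₑ * ‖α.toSpace X E u‖ₑ := by
    have norm_map_le : ‖α.toSpace Y F (LipTensor.map h T u)‖ ≤ 1 * ‖T‖ * ‖α.toSpace X E u‖ :=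
      (α.metric_mapping X Y E F h T u).trans <|
        mul_le_mul_of_nonneg_right (by gcongr; exact lipConst_le_one hh)
          (apply_nonneg (α.norm X E) u)
    simp only [enorm_eq_nnnorm]
    exact_mod_cast one_mul ‖T‖ ▸ norm_map_le
  calc ‖(LipTensor.map h T u).1 f‖ₑ
      ≤ α.dualNorm f * ‖α.toSpace Y F (LipTensor.map h T u)‖ₑ := enorm_apply_le_dualNorm_mul f _
    _ ≤ α.dualNorm f * (‖T‖ₑ * ‖α.toSpace X E u‖ₑ) := by gcongr
    _ = ‖T‖ₑ * α.dualNorm f * ‖α.toSpace X E u‖ₑ := by ring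

theorem IsFinitelyGenerated.dualNorm_le (hα : α.IsFinitelyGenerated)
    {f : Lip0 𝕜 X (StrongDual 𝕜 E)} {c : ℝ≥0∞}
    (hc : ∀ (Y : Finset X) (hY : X.base ∈ Y) (G : Submodule 𝕜 E) [FiniteDimensional 𝕜 G]
      [CompleteSpace G], α.dualNorm (Lip0.comp (dualOp G.subtypeL) (X.incl Y hY) f) ≤ c) :
    α.dualNorm f ≤ c := by
  induction c with
  | top => exact le_top
  | coe c =>
    refine dualNorm_le_coe_iff.2 fun u => ((hα X E u).mul_left c.2).2 ?_
    rintro _ ⟨_, ⟨Y, hY, G, hG, v, rfl, rfl⟩, rfl⟩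
    have := FiniteDimensional.complete 𝕜 G
    exact dualNorm_le_coe_iff.1 (hc Y hY G) v

end GenericLipCrossNorm

end DualNorm

section ExtNorm

variable {𝕜 : Type} [RCLike 𝕜] {X Z : PointedMetricSpace.{u}}
  {E F : Type v} [NormedAddCommGroup E] [NormedSpace 𝕜 E] [CompleteSpace E]
  [NormedAddCommGroup F] [NormedSpace 𝕜 F] [CompleteSpace F]

namespace GenericLipIdeal

variable {A : GenericLipIdeal.{u, v} 𝕜}

theorem extNorm_toLip0 (f : A.Space X E) : A.extNorm f.toLip0 = ‖f‖ₑ :=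
  (dif_pos f.2).trans (ofReal_norm f)

theorem extNorm_lt_top_iff {f : Lip0 𝕜 X E} : A.extNorm f < ∞ ↔ f ∈ A.carrier X E := by
  by_cases hf : f ∈ A.carrier X E <;> simp [extNorm, hf]

theorem extNorm_comp_le {S : E →L[𝕜] F} (hS : ‖S‖ ≤ 1) {h : LipMap Z X}
    (hh : LipschitzWith 1 h.toFun) (f : Lip0 𝕜 X E) :
    A.extNorm (Lip0.comp S h f) ≤ A.extNorm f := by
  by_cases hf : f ∈ A.carrier X E
  · obtain ⟨hmem, hle⟩ := A.ideal X Z E F ⟨f, hf⟩ h S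
    rw [extNorm, extNorm, dif_pos hf, dif_pos hmem]
    refine ENNReal.ofReal_le_ofReal (hle.trans ?_)
    have norm_nonneg : 0 ≤ A.norm X E ⟨f, hf⟩ := apply_nonneg _ _
    calc ‖S‖ * A.norm X E ⟨f, hf⟩ * lipConst h.toFun
        ≤ ‖S‖ * A.norm X E ⟨f, hf⟩ :=
          mul_le_of_le_one_right (by positivity) (lipConst_le_one hh)
      _ ≤ A.norm X E ⟨f, hf⟩ := mul_le_of_le_one_left norm_nonneg hS
  · simp [extNorm, hf]

theorem IsMaximal.extNorm_eq_maxNorm (hA : A.IsMaximal) (f : Lip0 𝕜 X E) :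
    A.extNorm f = A.maxNorm f := by
  by_cases hf : f ∈ A.carrier X E
  · exact (dif_pos hf).trans ((hA X E).2 ⟨f, hf⟩)
  · rw [extNorm, dif_neg hf, eq_comm, ← not_lt_top_iff, ← (hA X E).1]
    exact hf

theorem IsMaximal.extNorm_le_iff (hA : A.IsMaximal) {f : Lip0 𝕜 X E} {c : ℝ≥0∞} :
    A.extNorm f ≤ c ↔ ∀ (Y : Finset X) (hY : X.base ∈ Y) (L : Submodule 𝕜 E)
      [IsClosed (L : Set E)] [FiniteDimensional 𝕜 (E ⧸ L)],
      A.extNorm (Lip0.comp L.mkQL (X.incl Y hY) f) ≤ c := by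
  rw [hA.extNorm_eq_maxNorm, maxNorm]
  simp only [iSup_le_iff]

theorem IsMaximal.extNorm_toBidual (hA : A.IsMaximal) (f : Lip0 𝕜 X E) :
    A.extNorm (Lip0.toBidual f) = A.extNorm f := by
  refine le_antisymm (extNorm_comp_le (NormedSpace.inclusionInDoubleDual_norm_le 𝕜 E)
    LipschitzWith.id f) (hA.extNorm_le_iff.2 fun Y hY L _ _ => ?_)
  obtain ⟨R, hR, hRκ⟩ := exists_leftInverse_inclusionInDoubleDual 𝕜 (E ⧸ L)
  have norm_bidual_le : ‖dualOp (dualOp L.mkQL)‖ ≤ 1 :=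
    (norm_dualOp_le _).trans <| (norm_dualOp_le _).trans (norm_mkQL_le L)
  have comp_toBidual_eq : Lip0.comp (R ∘L dualOp (dualOp L.mkQL)) (X.incl Y hY) (Lip0.toBidual f)
      = Lip0.comp L.mkQL (X.incl Y hY) f := by
    ext y
    exact hRκ (L.mkQL (f.1 y.1))
  rw [← comp_toBidual_eq]
  exact extNorm_comp_le ((R.opNorm_comp_le _).trans (mul_le_one₀ hR (norm_nonneg _)
    norm_bidual_le)) (lipschitzWith_incl Y hY) _

theorem IsMaximal.toBidual_mem_carrier_iff (hA : A.IsMaximal) {f : Lip0 𝕜 X E} :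
    Lip0.toBidual f ∈ A.carrier X (StrongDual 𝕜 (StrongDual 𝕜 E)) ↔ f ∈ A.carrier X E := by
  rw [← extNorm_lt_top_iff, hA.extNorm_toBidual, extNorm_lt_top_iff]

/-- The isometric embedding `f ↦ κ_E ∘ f` of `A(X, E)` into `A(X, E**)`, for a maximal ideal. -/
noncomputable def IsMaximal.toBidualLi (hA : A.IsMaximal) :
    A.Space X E →ₗᵢ[𝕜] A.Space X (StrongDual 𝕜 (StrongDual 𝕜 E)) where
  toFun f := ⟨Lip0.toBidual f.toLip0, hA.toBidual_mem_carrier_iff.2 f.2⟩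
  map_add' f g := Subtype.ext (map_add Lip0.toBidual f.toLip0 g.toLip0)
  map_smul' c f := Subtype.ext (map_smul Lip0.toBidual c f.toLip0)
  norm_map' f := enorm_eq_iff_norm_eq.1 <|
    (extNorm_toLip0 _).symm.trans <| (hA.extNorm_toBidual _).trans (extNorm_toLip0 f)

end GenericLipIdeal

end ExtNorm

section Association

variable {𝕜 : Type} [RCLike 𝕜] {A : GenericLipIdeal.{u, v} 𝕜} {α : GenericLipCrossNorm.{u, v} 𝕜}
  {X : PointedMetricSpace.{u}} {E : Type v}
  [NormedAddCommGroup E] [NormedSpace 𝕜 E] [CompleteSpace E]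

variable (A α X E) in
/-- The relation `A(X, E*) = (X ⊠_α E)*`, isometrically through `f ↦ (u ↦ u(f))`, for a given pair
`X, E`; `AreAssociated A α` demands it for all finite `X` and finite-dimensional `E`. -/
def AssociatedAt : Prop :=
  ∃ Φ : A.Space X (StrongDual 𝕜 E) ≃ₗᵢ[𝕜] StrongDual 𝕜 (α.Space X E),
    ∀ (f : A.Space X (StrongDual 𝕜 E)) (u : LipTensor 𝕜 X E),
      Φ f (α.toSpace X E u) = u.1 f.toLip0

theorem AssociatedAt.extNorm_eq_dualNorm (h : AssociatedAt A α X E)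
    (f : Lip0 𝕜 X (StrongDual 𝕜 E)) : A.extNorm f = α.dualNorm f := by
  obtain ⟨Φ, hΦ⟩ := h
  have extNorm_toLip0_eq (g : A.Space X (StrongDual 𝕜 E)) :
      A.extNorm g.toLip0 = α.dualNorm g.toLip0 := by
    rw [GenericLipIdeal.extNorm_toLip0, GenericLipCrossNorm.dualNorm_eq_enorm (hΦ g),
      ← ofReal_norm, ← ofReal_norm, Φ.norm_map]
  by_cases hf : α.dualNorm f < ∞
  · obtain ⟨φ, hφ⟩ := GenericLipCrossNorm.dualNorm_lt_top_iff.1 hf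
    have toLip0_eq : (Φ.symm φ).toLip0 = f := LipTensor.evalAt_injective <| LinearMap.ext fun u =>
      (hΦ _ u).symm.trans <| (congrArg (· (α.toSpace X E u)) (Φ.apply_symm_apply φ)).trans (hφ u)
    exact toLip0_eq ▸ extNorm_toLip0_eq (Φ.symm φ)
  · have f_notMem : f ∉ A.carrier X (StrongDual 𝕜 E) := fun hmem =>
      hf <| extNorm_toLip0_eq ⟨f, hmem⟩ ▸ GenericLipIdeal.extNorm_lt_top_iff.2 hmem
    rw [not_lt_top_iff.1 hf, ← not_lt_top_iff, GenericLipIdeal.extNorm_lt_top_iff]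
    exact f_notMem

theorem associatedAt_of_extNorm_eq_dualNorm
    (h : ∀ f : Lip0 𝕜 X (StrongDual 𝕜 E), A.extNorm f = α.dualNorm f) :
    AssociatedAt A α X E := by
  have exists_functional (f : A.Space X (StrongDual 𝕜 E)) :
      ∃ φ : StrongDual 𝕜 (α.Space X E), ∀ u, φ (α.toSpace X E u) = u.1 f.toLip0 :=
    GenericLipCrossNorm.dualNorm_lt_top_iff.1 <|
      h f.toLip0 ▸ GenericLipIdeal.extNorm_lt_top_iff.2 f.2
  choose Φ hΦ using exists_functional
  let Φₗ : A.Space X (StrongDual 𝕜 E) →ₗᵢ[𝕜] StrongDual 𝕜 (α.Space X E) :=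
    { toFun := Φ
      map_add' := fun f g => ContinuousLinearMap.ext fun u =>
        (hΦ _ u).trans <| (map_add u.1 f.toLip0 g.toLip0).trans <|
          congrArg₂ (· + ·) (hΦ f u).symm (hΦ g u).symm
      map_smul' := fun c f => ContinuousLinearMap.ext fun u =>
        (hΦ _ u).trans <| (map_smul u.1 c f.toLip0).trans <| congrArg (c • ·) (hΦ f u).symm
      norm_map' := fun f => by
        have := h f.toLip0
        rw [GenericLipIdeal.extNorm_toLip0, GenericLipCrossNorm.dualNorm_eq_enorm (hΦ f)] at this
        exact (enorm_eq_iff_norm_eq.1 this).symm }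
  have Φₗ_surjective : Function.Surjective Φₗ := fun φ => by
    obtain ⟨f, hf⟩ := LipTensor.exists_evalAt_eq_of_bound (C := ‖φ‖₊)
      (φ : α.Space X E →ₗ[𝕜] 𝕜) fun x y e => φ.le_opNorm_of_le (α.cross X E x y e).le
    have hfφ : ∀ u, φ (α.toSpace X E u) = u.1 f := fun u => (LinearMap.congr_fun hf u).symm
    have f_mem : f ∈ A.carrier X (StrongDual 𝕜 E) := by
      rw [← GenericLipIdeal.extNorm_lt_top_iff, h, GenericLipCrossNorm.dualNorm_lt_top_iff]
      exact ⟨φ, hfφ⟩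
    exact ⟨⟨f, f_mem⟩, ContinuousLinearMap.ext fun u => (hΦ ⟨f, f_mem⟩ u).trans (hfφ u).symm⟩
  exact ⟨.ofSurjective Φₗ Φₗ_surjective, hΦ⟩

end Association

section DualityOfMaximalIdeal

open GenericLipCrossNorm GenericLipIdeal

variable {𝕜 : Type} [RCLike 𝕜] {A : GenericLipIdeal.{u, v} 𝕜} {α : GenericLipCrossNorm.{u, v} 𝕜}
  {X : PointedMetricSpace.{u}} {E : Type v}
  [NormedAddCommGroup E] [NormedSpace 𝕜 E] [CompleteSpace E]

theorem AreAssociated.extNorm_eq_dualNorm_sub {G : Type v} [NormedAddCommGroup G]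
    [NormedSpace 𝕜 G] [CompleteSpace G] [FiniteDimensional 𝕜 G] (hAα : AreAssociated A α)
    (Y : Finset X) (hY : X.base ∈ Y) (f : Lip0 𝕜 (X.sub Y hY) (StrongDual 𝕜 G)) :
    A.extNorm f = α.dualNorm f :=
  have : Finite (X.sub Y hY) := inferInstanceAs (Finite {x // x ∈ Y})
  AssociatedAt.extNorm_eq_dualNorm (hAα (X.sub Y hY) G) f

theorem dualNorm_le_extNorm (hα : α.IsFinitelyGenerated) (hAα : AreAssociated A α)
    (f : Lip0 𝕜 X (StrongDual 𝕜 E)) : α.dualNorm f ≤ A.extNorm f := by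
  refine hα.dualNorm_le fun Y hY G _ _ => ?_
  refine (hAα.extNorm_eq_dualNorm_sub Y hY _).symm.trans_le ?_
  exact extNorm_comp_le ((norm_dualOp_le G.subtypeL).trans G.norm_subtypeL_le)
    (lipschitzWith_incl Y hY) f

theorem extNorm_le_dualNorm (hA : A.IsMaximal) (hAα : AreAssociated A α)
    (f : Lip0 𝕜 X (StrongDual 𝕜 E)) : A.extNorm f ≤ α.dualNorm f := by
  refine hA.extNorm_le_iff.2 fun Y hY L _ _ => ?_
  have extNorm_le_mul {K : NNReal} (hK : 1 < K) :
      A.extNorm (Lip0.comp L.mkQL (X.incl Y hY) f) ≤ K * α.dualNorm f := by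
    obtain ⟨T, hT, hTf⟩ := exists_comp_dualOp_eq_toBidual_comp f Y hY (norm_mkQL_le L)
      (NNReal.one_lt_coe.2 hK)
    calc A.extNorm (Lip0.comp L.mkQL (X.incl Y hY) f)
        = A.extNorm (Lip0.toBidual (Lip0.comp L.mkQL (X.incl Y hY) f)) :=
          (hA.extNorm_toBidual _).symm
      _ = A.extNorm (Lip0.comp (dualOp T) (X.incl Y hY) f) := by rw [hTf]
      _ = α.dualNorm (Lip0.comp (dualOp T) (X.incl Y hY) f) :=
          hAα.extNorm_eq_dualNorm_sub Y hY _
      _ ≤ ‖T‖ₑ * α.dualNorm f := dualNorm_comp_le (lipschitzWith_incl Y hY) T f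
      _ ≤ K * α.dualNorm f := mul_le_mul_left (enorm_le_coe.2 hT.le) _
  have tendsto_mul : Tendsto (fun K : NNReal => K * α.dualNorm f) (𝓝[>] 1) (𝓝 (1 * α.dualNorm f)) :=
    ENNReal.Tendsto.mul_const (ENNReal.tendsto_coe.2 nhdsWithin_le_nhds) (.inl one_ne_zero)
  exact one_mul (α.dualNorm f) ▸
    ge_of_tendsto tendsto_mul (eventually_mem_nhdsWithin.mono fun K => extNorm_le_mul)

theorem extNorm_eq_dualNorm (hA : A.IsMaximal) (hα : α.IsFinitelyGenerated)
    (hAα : AreAssociated A α) (f : Lip0 𝕜 X (StrongDual 𝕜 E)) : A.extNorm f = α.dualNorm f :=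
  (extNorm_le_dualNorm hA hAα f).antisymm (dualNorm_le_extNorm hα hAα f)

theorem AreAssociated.associatedAt (hAα : AreAssociated A α) (hA : A.IsMaximal)
    (hα : α.IsFinitelyGenerated) :
    AssociatedAt A α X E :=
  associatedAt_of_extNorm_eq_dualNorm (extNorm_eq_dualNorm hA hα hAα)

end DualityOfMaximalIdeal

theorem mainTheorem2 {𝕜 : Type} [RCLike 𝕜]
    (A : GenericLipIdeal.{u, v} 𝕜) (α : GenericLipCrossNorm.{u, v} 𝕜)
    (hA : A.IsMaximal) (hα : α.IsFinitelyGenerated) (hAα : AreAssociated A α)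
    (X : PointedMetricSpace.{u}) (E : Type v)
    [NormedAddCommGroup E] [NormedSpace 𝕜 E] [CompleteSpace E] :
    (∃ Φ : A.Space X (StrongDual 𝕜 E) ≃ₗᵢ[𝕜]
          StrongDual 𝕜 (UniformSpace.Completion (α.Space X E)),
        ∀ (f : A.Space X (StrongDual 𝕜 E)) (u : LipTensor 𝕜 X E),
          Φ f (α.toSpace X E u : UniformSpace.Completion (α.Space X E)) = u.1 f.toLip0) ∧
    (∃ Ψ : A.Space X E →ₗᵢ[𝕜]
          StrongDual 𝕜 (UniformSpace.Completion (α.Space X (StrongDual 𝕜 E))),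
        (∀ (f : A.Space X E) (u : LipTensor 𝕜 X (StrongDual 𝕜 E)),
          Ψ f (α.toSpace X (StrongDual 𝕜 E) u :
              UniformSpace.Completion (α.Space X (StrongDual 𝕜 E)))
            = u.1 (Lip0.toBidual f.toLip0)) ∧
        ∀ f : Lip0 𝕜 X E,
          f ∈ A.carrier X E ↔
            ∃ φ : StrongDual 𝕜 (UniformSpace.Completion (α.Space X (StrongDual 𝕜 E))),
              ∀ u : LipTensor 𝕜 X (StrongDual 𝕜 E),
                φ (α.toSpace X (StrongDual 𝕜 E) u :
                    UniformSpace.Completion (α.Space X (StrongDual 𝕜 E)))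
                  = u.1 (Lip0.toBidual f)) := by
  let δ (F : Type v) [NormedAddCommGroup F] [NormedSpace 𝕜 F] [CompleteSpace F] :=
    dualCompletionEquiv 𝕜 (α.Space X F)
  obtain ⟨Φ, hΦ⟩ : AssociatedAt A α X E := hAα.associatedAt hA hα
  obtain ⟨Ψ, hΨ⟩ : AssociatedAt A α X (StrongDual 𝕜 E) := hAα.associatedAt hA hα
  refine ⟨⟨Φ.trans (δ E), fun f u => ?_⟩,
    (Ψ.trans (δ (StrongDual 𝕜 E))).toLinearIsometry.comp hA.toBidualLi, fun f u => ?_, fun f => ?_⟩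
  · exact (dualCompletionEquiv_apply_coe _ _).trans (hΦ f u)
  · exact (dualCompletionEquiv_apply_coe _ _).trans (hΨ (hA.toBidualLi f) u)
  · rw [← hA.toBidual_mem_carrier_iff, ← GenericLipIdeal.extNorm_lt_top_iff,
      extNorm_eq_dualNorm hA hα hAα, GenericLipCrossNorm.dualNorm_lt_top_iff]
    exact (δ (StrongDual 𝕜 E)).toEquiv.exists_congr fun φ => by simp [δ]
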